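/- Let $n \ge 0$, $m \ge 0$ and let $A = (a_{ij})$ be an $m \times (n+1)$ integer matrix with columns $A_0,\dots,A_n$ all of whose column sums are equal. Let $$I_A = \langle p^v - p^w : v, w \in \mathbb{N}^{n+1},\ Av = Aw\rangle \subseteq \mathbb{C}[p_0,\dots,p_n]$$ be its toric ideal, and assume that $I_A$ is homogeneous (this is automatic when the common column sum is nonzero). Let $\mathcal{M} \subseteq \mathbb{P}^n_p$ be the toric model defined by $A$, that is, the Zariski closure of the image of $(\mathbb{C}^*)^m \to \mathbb{P}^n$, $\theta \mapsto [\theta^{A_0} : \cdots : \theta^{A_n}]$. Write $p_+ = \sum_i p_i$, $u_+ = \sum_i u_i$, let $\mathcal{H} \subseteq \mathbb{P}^n_p$ be the union of the hyperplanes $p_0 = 0, \dots, p_n = 0$ and $p_+ = 0$, and let $\mathcal{M}_{\mathrm{reg}}$ be the smooth locus of $\mathcal{M}$. The likelihood correspondence of $\mathcal{M}$ is the Zariski closure $$\mathcal{L}_{\mathcal{M}} = \overline{\{(p,u) \in (\mathcal{M}_{\mathrm{reg}} \setminus \mathcal{H}) \times \mathbb{P}^n_u : \operatorname{dlog} \ell_u|_{\mathcal{M}}(p)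 = 0\}} \subseteq \mathbb{P}^n_p \times \mathbb{P}^n_u, \qquad \operatorname{dlog}\ell_u(p) = \sum_{i=0}^n \Big(\frac{u_i}{p_i} - \frac{u_+}{p_+}\Big)\,dp_i,$$ and the likelihood ideal of $\mathcal{M}$ is its vanishing ideal in $\mathbb{C}[p_0,\dots,p_n,u_0,\dots,u_n]$. Let $M$ be the $(n+1)\times 2$ matrix with columns $u = (u_0,\dots,u_n)^T$ and $p = (p_0,\dots,p_n)^T$, and let $I_2(AM)$ be the ideal generated by the $2 \times 2$ minors of the $m\times 2$ matrix $AM$. Then $$(I_A + I_2(AM)) : \langle p_0 p_1 \cdots p_n\, p_+ \rangle^\infty$$ is the likelihood ideal of $\mathcal{M}$. Moreover, away from $\mathcal{H}$ the likelihood correspondence is the locus where $Au$ is proportional to $Ap$: for $(p,u) \in (\mathbb{P}^n_p \setminus \mathcal{H}) \times \mathbb{P}^n_u$ one has $(p,u) \in \mathcal{L}_{\mathcal{M}}$ if and only if $p \in \mathcal{M}$ and $Au = c\,Ap$ for some $c \in \mathbb{C}$ (possibly $c = 0$). -/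

import Mathlib

open scoped LinearAlgebra.Projectivization

namespace LikelihoodGeometry

open MvPolynomial

noncomputable section

/-- The coordinate ring `ℂ[p_0, …, p_n]` of `ℙⁿ_p`. -/
abbrev PRing (n : ℕ) : Type := MvPolynomial (Fin (n + 1)) ℂ

/-- The coordinate ring `ℂ[p_0, …, p_n, u_0, …, u_n]` of `ℙⁿ_p × ℙⁿ_u`; the variable `p_j` is
`X (Sum.inl j)` and the variable `u_j` is `X (Sum.inr j)`. -/
abbrev PURing (n : ℕ) : Type := MvPolynomial (Fin (n + 1) ⊕ Fin (n + 1)) ℂ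

/-- Complex projective space `ℙⁿ`. -/
abbrev PSpace (n : ℕ) : Type := ℙ ℂ (Fin (n + 1) → ℂ)

/-! ### Zariski closed sets and vanishing ideals in `ℙⁿ` and in `ℙⁿ × ℙⁿ` -/

/-- `f` vanishes at the point `x` of `ℙⁿ`: it is zero at every representative of `x`
(equivalently, every homogeneous component of `f` vanishes at `x`). -/
def VanishesAt {n : ℕ} (f : PRing n) (x : PSpace n) : Prop :=
  ∀ (p : Fin (n + 1) → ℂ) (hp : p ≠ 0), Projectivization.mk ℂ p hp = x → eval p f = 0

/-- The homogeneous vanishing ideal of a set of points of `ℙⁿ`. -/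
def vanishingIdeal {n : ℕ} (S : Set (PSpace n)) : Ideal (PRing n) where
  carrier := {f | ∀ x ∈ S, VanishesAt f x}
  zero_mem' := fun _ _ _ _ _ => map_zero _
  add_mem' := fun ha hb x hx p hp h => by
    rw [map_add, ha x hx p hp h, hb x hx p hp h, add_zero]
  smul_mem' := fun c f hf x hx p hp h => by
    rw [smul_eq_mul, map_mul, hf x hx p hp h, mul_zero]

/-- The Zariski closure of a set of points of `ℙⁿ`. -/
def zariskiClosure {n : ℕ} (S : Set (PSpace n)) : Set (PSpace n) :=
  {x | ∀ f ∈ vanishingIdeal S, VanishesAt f x}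

/-- `f` vanishes at the point `z` of `ℙⁿ × ℙⁿ`: it is zero at every pair of representatives of
`z` (equivalently, every bihomogeneous component of `f` vanishes at `z`). -/
def VanishesAt₂ {n : ℕ} (f : PURing n) (z : PSpace n × PSpace n) : Prop :=
  ∀ (p u : Fin (n + 1) → ℂ) (hp : p ≠ 0) (hu : u ≠ 0),
    (Projectivization.mk ℂ p hp, Projectivization.mk ℂ u hu) = z →
      eval (Sum.elim p u) f = 0

/-- The bihomogeneous vanishing ideal of a set of points of `ℙⁿ × ℙⁿ`. -/
def vanishingIdeal₂ {n : ℕ} (S : Set (PSpace n × PSpace n)) : Ideal (PURing n) where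
  carrier := {f | ∀ z ∈ S, VanishesAt₂ f z}
  zero_mem' := fun _ _ _ _ _ _ _ => map_zero _
  add_mem' := fun ha hb z hz p u hp hu h => by
    rw [map_add, ha z hz p u hp hu h, hb z hz p u hp hu h, add_zero]
  smul_mem' := fun c f hf z hz p u hp hu h => by
    rw [smul_eq_mul, map_mul, hf z hz p u hp hu h, mul_zero]

/-- The Zariski closure of a set of points of `ℙⁿ × ℙⁿ`. -/
def zariskiClosure₂ {n : ℕ} (S : Set (PSpace n × PSpace n)) : Set (PSpace n × PSpace n) :=
  {z | ∀ f ∈ vanishingIdeal₂ S, VanishesAt₂ f z}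

/-! ### The likelihood correspondence of a closed irreducible `M ⊆ ℙⁿ` -/

/-- The Zariski tangent space, at the vector `p`, of the affine cone over `M`: the kernel of the
Jacobian matrix at `p` of the vanishing ideal of `M`. -/
def tangentSpace {n : ℕ} (M : Set (PSpace n)) (p : Fin (n + 1) → ℂ) :
    Submodule ℂ (Fin (n + 1) → ℂ) where
  carrier := {v | ∀ f ∈ vanishingIdeal M, ∑ i, eval p (pderiv i f) * v i = 0}
  zero_mem' := fun f _ => by simp
  add_mem' := fun ha hb f hf => by
    simp only [Pi.add_apply, mul_add, Finset.sum_add_distrib]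
    rw [ha f hf, hb f hf, add_zero]
  smul_mem' := fun c v hv f hf => by
    simp only [Pi.smul_apply, smul_eq_mul, mul_left_comm _ c, ← Finset.mul_sum]
    rw [hv f hf, mul_zero]

/-- The smooth locus `M_reg` of a closed irreducible `M ⊆ ℙⁿ` (Jacobian criterion): the points at
which the tangent space of the affine cone over `M` has the dimension of that cone, namely
the Krull dimension `dim M + 1` of the homogeneous coordinate ring of `M`. -/
def regularLocus {n : ℕ} (M : Set (PSpace n)) : Set (PSpace n) :=
  {x | x ∈ M ∧ ∃ (p : Fin (n + 1) → ℂ) (hp : p ≠ 0), Projectivization.mk ℂ p hp = x ∧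
    ((Module.finrank ℂ (tangentSpace M p) : ℕ) : WithBot ℕ∞) =
      ringKrullDim (PRing n ⧸ vanishingIdeal M)}

/-- `p` lies off the arrangement `H` of the `n + 2` hyperplanes `p_i = 0` and `p_+ = 0`. -/
def OffHyperplanes {n : ℕ} (p : Fin (n + 1) → ℂ) : Prop :=
  (∀ i, p i ≠ 0) ∧ ∑ i, p i ≠ 0

/-- The value at the tangent vector `v` of the one-form
`dlog ℓ_u (p) = ∑ i, (u_i / p_i - u_+ / p_+) dp_i`, the logarithmic differential of the likelihood
function `ℓ_u (p) = (∏ i, p_i ^ u_i) / p_+ ^ u_+`. -/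
def dlogLikelihood {n : ℕ} (u p v : Fin (n + 1) → ℂ) : ℂ :=
  ∑ i, (u i / p i - (∑ j, u j) / (∑ j, p j)) * v i

/-- The pairs `(p, u)` with `p ∈ M_reg \ H` at which the restriction of `dlog ℓ_u` to `M`
vanishes. The form `dlog ℓ_u` is homogeneous of degree zero and kills the Euler vector field, so
it may be tested on the tangent space of the affine cone, at any representatives. -/
def criticalPairs {n : ℕ} (M : Set (PSpace n)) : Set (PSpace n × PSpace n) :=
  {z | ∃ (p u : Fin (n + 1) → ℂ) (hp : p ≠ 0) (hu : u ≠ 0),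
    z = (Projectivization.mk ℂ p hp, Projectivization.mk ℂ u hu) ∧
    Projectivization.mk ℂ p hp ∈ regularLocus M ∧ OffHyperplanes p ∧
    ∀ v ∈ tangentSpace M p, dlogLikelihood u p v = 0}

/-- The likelihood correspondence `L_M ⊆ ℙⁿ_p × ℙⁿ_u`. -/
def likelihoodCorrespondence {n : ℕ} (M : Set (PSpace n)) : Set (PSpace n × PSpace n) :=
  zariskiClosure₂ (criticalPairs M)

/-- The likelihood ideal of `M`: the vanishing ideal of its likelihood correspondence. -/
def likelihoodIdeal {n : ℕ} (M : Set (PSpace n)) : Ideal (PURing n) :=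
  vanishingIdeal₂ (likelihoodCorrespondence M)

/-! ### Toric models -/

/-- The vector `(θ^{A_0}, …, θ^{A_n})`, where `A_j` is the `j`-th column of `A` and `θ` is a point
of the torus `(ℂ^*)^m`. -/
def monomialVector {m n : ℕ} (A : Matrix (Fin m) (Fin (n + 1)) ℤ) (θ : Fin m → ℂˣ) :
    Fin (n + 1) → ℂ :=
  fun j => ((∏ i, θ i ^ A i j : ℂˣ) : ℂ)

theorem monomialVector_ne_zero {m n : ℕ} (A : Matrix (Fin m) (Fin (n + 1)) ℤ)
    (θ : Fin m → ℂˣ) : monomialVector A θ ≠ 0 :=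
  fun h => Units.ne_zero _ (congrFun h 0)

/-- The toric model defined by `A`: the Zariski closure in `ℙⁿ` of the image of
`θ ↦ [θ^{A_0} : ⋯ : θ^{A_n}]`. -/
def toricModel {m n : ℕ} (A : Matrix (Fin m) (Fin (n + 1)) ℤ) : Set (PSpace n) :=
  zariskiClosure (Set.range fun θ : Fin m → ℂˣ =>
    Projectivization.mk ℂ (monomialVector A θ) (monomialVector_ne_zero A θ))

/-- The toric ideal `I_A`, generated by all `p^v - p^w` with `v, w ∈ ℕ^{n+1}` and `A v = A w`. -/
def toricIdeal {m n : ℕ} (A : Matrix (Fin m) (Fin (n + 1)) ℤ) : Ideal (PRing n) :=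
  Ideal.span {f | ∃ v w : Fin (n + 1) → ℕ,
    A.mulVec (fun j => (v j : ℤ)) = A.mulVec (fun j => (w j : ℤ)) ∧
    f = ∏ j, X j ^ v j - ∏ j, X j ^ w j}

/-! ### Determinantal ideals and saturation -/

/-- `I_k(N)`, the ideal generated by the `k × k` minors of `N`. (Repeated indices contribute
zero, and reordered ones a sign.) -/
def minorsIdeal {R : Type*} [CommRing R] {a b : ℕ} (k : ℕ) (N : Matrix (Fin a) (Fin b) R) :
    Ideal R :=
  Ideal.span {d | ∃ (r : Fin k → Fin a) (c : Fin k → Fin b), d = (N.submatrix r c).det}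

/-- The saturation `I : J^∞ = ⋃ k, (I : J^k)`. -/
def saturation {R : Type*} [CommRing R] (I J : Ideal R) : Ideal R where
  carrier := {f | ∃ k : ℕ, ∀ g ∈ J ^ k, f * g ∈ I}
  zero_mem' := ⟨0, fun g _ => by rw [zero_mul]; exact I.zero_mem⟩
  add_mem' := fun {a b} ⟨k, hk⟩ ⟨l, hl⟩ => ⟨k + l, fun g hg => by
    rw [add_mul]
    exact I.add_mem (hk g (Ideal.pow_le_pow_right (Nat.le_add_right k l) hg))
      (hl g (Ideal.pow_le_pow_right (Nat.le_add_left l k) hg))⟩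
  smul_mem' := fun c f ⟨k, hk⟩ => ⟨k, fun g hg => by
    rw [smul_eq_mul, mul_assoc]
    exact I.mul_mem_left c (hk g hg)⟩

/-- The `(n+1) × 2` matrix with columns `u` and `p`. -/
def dataMatrix (n : ℕ) : Matrix (Fin (n + 1)) (Fin 2) (PURing n) :=
  Matrix.of fun j => ![X (Sum.inr j), X (Sum.inl j)]

/-- The product `p_0 p_1 ⋯ p_n p_+` in the coordinate ring of `ℙⁿ_p × ℙⁿ_u`. -/
def hyperplaneProduct (n : ℕ) : PURing n :=
  (∏ j : Fin (n + 1), X (Sum.inl j)) * ∑ j : Fin (n + 1), X (Sum.inl j)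

/-- The ideal `(I_A + I_2(A·M)) : ⟨p_0 p_1 ⋯ p_n p_+⟩^∞`. -/
def toricLikelihoodIdeal {m n : ℕ} (A : Matrix (Fin m) (Fin (n + 1)) ℤ) : Ideal (PURing n) :=
  saturation
    ((toricIdeal A).map (rename Sum.inl : PRing n →ₐ[ℂ] PURing n) +
      minorsIdeal 2 (A.map (Int.cast : ℤ → PURing n) * dataMatrix n))
    (Ideal.span {hyperplaneProduct n})

end

end LikelihoodGeometry

/-!
Write `I_A` for the toric ideal of `A`. It is the kernel of the map `p_j ↦ t ^ A_j` to the Laurent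
polynomial ring (`toricIdeal_eq_ker`), hence prime, and by independence of the characters of the
torus it is the ideal of the orbit `{θ ^ A}` in affine space (`mem_toricIdeal_iff`). As it is
homogeneous, it is also the vanishing ideal of the toric model (`vanishingIdeal_toricModel`), and
`(1, …, 1)` lies in the row space of `A` (`exists_transpose_mulVec_eq_one`).

*Critical points.* At a point `p` of the model with nonzero coordinates the tangent space of the
cone is `diag(p)` times the row space of `A` (`mem_tangentSpace_iff`). Its dimension is the rank of
`A`, and so is the Krull dimension of `ℂ[p] / I_A` (`ringKrullDim_quotient_toricIdeal`), so all
these points are smooth. On such tangent vectors `dlog ℓ_u` pairs to `A u - (u_+ / p_+) A p`.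
Therefore the critical pairs are the pairs `(p, u)` with `p` in the model off the hyperplanes and
`A u` proportional to `A p` (`mem_criticalPairs_iff`), the factor being forced to be `u_+ / p_+`.

*The ideal.* The generators of `I_A` and the minors vanish at critical pairs, and the product
`p_0 ⋯ p_n p_+` does not, which gives one inclusion. For the other, after inverting `p_+` the minors
amount to the equations `A u = (u_+ / p_+) A p`, linear in `u` (`momentEquation_mem_minorsIdeal`).
A generalized inverse of `A` parametrizes their solutions over the `p`-space by an arbitrary vector
`u`. Substituting this parametrization into a polynomial that vanishes on the critical pairs does
not change it modulo the minors, and makes each of its coefficients in `u` a polynomial in `p` that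
vanishes on the model off the hyperplanes. Multiplied by `p_0 ⋯ p_n p_+`, such a coefficient lies
in `I_A` (`mul_hyperplaneProduct_scaleData_mem`). No Nullstellensatz is needed.

*The closure.* The binomials and the moment equations `p_+ A u = u_+ A p` lie in the likelihood
ideal, so they hold on the closure, and where `p_+ ≠ 0` they say that `A u` is proportional to
`A p`.
-/

namespace LikelihoodGeometry

open MvPolynomial

/-! ### Integer matrices and their complex row spaces -/

theorem exists_generalized_inverse {K : Type*} [Field K] {m n : ℕ}
    (M : Matrix (Fin m) (Fin n) K) : ∃ G : Matrix (Fin n) (Fin m) K, M * G * M = M := by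
  obtain ⟨r, hr⟩ := (Matrix.toLin' M).rangeRestrict.exists_rightInverse_of_surjective
    (Matrix.toLin' M).range_rangeRestrict
  obtain ⟨g, hg⟩ := LinearMap.exists_extend r
  refine ⟨LinearMap.toMatrix' g, ?_⟩
  apply Matrix.toLin'.injective
  rw [Matrix.toLin'_mul, Matrix.toLin'_mul, Matrix.toLin'_toMatrix']
  refine LinearMap.ext fun x => ?_
  have h1 : g (Matrix.toLin' M x) = r ((Matrix.toLin' M).rangeRestrict x) := by
    rw [← hg]; rfl
  have h2 := LinearMap.congr_fun hr ((Matrix.toLin' M).rangeRestrict x)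
  rw [LinearMap.comp_apply, LinearMap.comp_apply, h1]
  exact congrArg Subtype.val h2

/-- An integer matrix has a generalized inverse `B / N` over `ℚ`. Its point is that the columns of
`N • 1 - B * A` are integer vectors that span the kernel of `A` over every field of characteristic
zero, so that no base change of kernels is needed. -/
theorem exists_int_generalized_inverse {m n : ℕ} (A : Matrix (Fin m) (Fin n) ℤ) :
    ∃ (N : ℤ) (B : Matrix (Fin n) (Fin m) ℤ), N ≠ 0 ∧ A * B * A = N • A := by
  obtain ⟨G, hG⟩ := exists_generalized_inverse (A.map (Int.castRingHom ℚ))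
  obtain ⟨N, hN⟩ := IsLocalization.exist_integer_multiples_of_finite (nonZeroDivisors ℤ)
    (fun e : Fin n × Fin m => G e.1 e.2)
  choose B hB using hN
  refine ⟨N, Matrix.of fun i j => B (i, j), nonZeroDivisors.coe_ne_zero N, ?_⟩
  have hBG : (Matrix.of fun i j => B (i, j)).map (Int.castRingHom ℚ) = ((N : ℤ) : ℚ) • G := by
    ext i j
    have := hB (i, j)
    simpa using this
  have key : (A * (Matrix.of fun i j => B (i, j)) * A).map (Int.castRingHom ℚ) =
      ((N : ℤ) • A).map (Int.castRingHom ℚ) := by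
    rw [Matrix.map_mul, Matrix.map_mul, hBG, Matrix.mul_smul, Matrix.smul_mul, hG]
    ext i j
    simp
  exact Matrix.map_injective Int.cast_injective key

/-- The complex row space of `A` is cut out by the integer kernel of `A` alone. -/
theorem mem_range_transpose_of_orthogonal {m n : ℕ} (A : Matrix (Fin m) (Fin n) ℤ)
    (z : Fin n → ℂ)
    (hz : ∀ k : Fin n → ℤ, A.mulVec k = 0 → ∑ i, (k i : ℂ) * z i = 0) :
    ∃ y : Fin m → ℂ, z = (A.map (Int.cast : ℤ → ℂ)).transpose.mulVec y := by
  obtain ⟨N, B, hN, hAB⟩ := exists_int_generalized_inverse A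
  have hNC : (N : ℂ) ≠ 0 := by exact_mod_cast hN
  refine ⟨(N : ℂ)⁻¹ • (B.map (Int.cast : ℤ → ℂ)).transpose.mulVec z, ?_⟩
  have hker (j : Fin n) : A.mulVec ((N • (1 : Matrix (Fin n) (Fin n) ℤ) - B * A).col j) = 0 := by
    have : A * (N • (1 : Matrix (Fin n) (Fin n) ℤ) - B * A) = 0 := by
      rw [Matrix.mul_sub, ← Matrix.mul_assoc, hAB, Matrix.mul_smul, Matrix.mul_one, sub_self]
    ext i
    exact congrFun (congrFun this i) j
  ext j
  have h := hz _ (hker j)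
  have h' : (N : ℂ) * z j = ∑ i, ((B * A) i j : ℂ) * z i := by
    simp only [Matrix.col_apply, Matrix.sub_apply, Matrix.smul_apply, Matrix.one_apply,
      Int.cast_sub, sub_mul, Finset.sum_sub_distrib, sub_eq_zero] at h
    rw [← h]
    simp
  rw [Matrix.mulVec_smul, Pi.smul_apply, smul_eq_mul, eq_inv_mul_iff_mul_eq₀ hNC, h',
    Matrix.mulVec_mulVec, ← Matrix.transpose_mul]
  simp only [Matrix.mulVec, dotProduct, Matrix.transpose_apply, Matrix.mul_apply, Matrix.map_apply,
    Int.cast_sum, Int.cast_mul]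

/-! ### Monomial maps into Laurent algebras -/

section ToricKernel

variable {σ G : Type*} [AddCommGroup G] (R : Type*) [CommRing R]

/-- The algebra map `R[X_j] → R[G]` that sends `X_j` to the group element `a j`; for `G = ℤ^m` the
target is the Laurent polynomial ring and `X_j` goes to the Laurent monomial `t ^ (a j)`. -/
noncomputable def monomialMap (a : σ → G) : MvPolynomial σ R →ₐ[R] AddMonoidAlgebra R G :=
  aeval fun j => AddMonoidAlgebra.single (a j) 1

theorem monomialMap_monomial (a : σ → G) (v : σ →₀ ℕ) (c : R) :
    monomialMap R a (monomial v c) =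
      AddMonoidAlgebra.single (Finsupp.linearCombination ℕ a v) c := by
  rw [monomialMap, aeval_monomial, Finsupp.linearCombination_apply]
  simp only [AddMonoidAlgebra.single_pow, one_pow]
  induction v using Finsupp.induction with
  | zero => simp [Algebra.algebraMap_eq_smul_one, AddMonoidAlgebra.one_def]
  | single_add i k v hi hk ih =>
    classical
    rw [Finsupp.prod_add_index' (by simp [AddMonoidAlgebra.one_def])
        (by intros; simp [AddMonoidAlgebra.single_mul_single, add_smul]),
      Finsupp.sum_add_index' (by simp) (by intros; simp [add_smul]), mul_left_comm, ih]
    simp [AddMonoidAlgebra.single_mul_single]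

/-- The kernel of a monomial map is generated by binomials: choosing a representative monomial in each
fibre on exponents gives a linear section of the map, and a polynomial differs from the
representative of its image by a combination of binomials. -/
theorem ker_monomialMap (a : σ → G) :
    RingHom.ker (monomialMap R a) = Ideal.span {f | ∃ v w : σ →₀ ℕ,
      Finsupp.linearCombination ℕ a v = Finsupp.linearCombination ℕ a w ∧
      f = monomial v 1 - monomial w 1} := by
  apply le_antisymm
  · intro f hf
    set I := Ideal.span {f : MvPolynomial σ R | ∃ v w : σ →₀ ℕ,
      Finsupp.linearCombination ℕ a v = Finsupp.linearCombination ℕ a w ∧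
      f = monomial v 1 - monomial w 1}
    let s : G → (σ →₀ ℕ) := Function.invFun (Finsupp.linearCombination ℕ a)
    let ψ : (G →₀ R) →ₗ[R] MvPolynomial σ R :=
      Finsupp.linearCombination R fun b => monomial (s b) 1
    have key (f : MvPolynomial σ R) : f - ψ (monomialMap R a f).coeff ∈ I := by
      induction f using MvPolynomial.induction_on' with
      | monomial v c =>
        rw [monomialMap_monomial]
        simp only [ψ, AddMonoidAlgebra.coeff_single, Finsupp.linearCombination_single]
        have : (monomial v c : MvPolynomial σ R) = c • monomial v 1 := by
          simp [smul_monomial]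
        rw [this, ← smul_sub, smul_eq_C_mul]
        refine I.mul_mem_left _ (Ideal.subset_span ⟨_, _, ?_, rfl⟩)
        exact (Function.invFun_eq ⟨v, rfl⟩).symm
      | add f g hf hg =>
        rw [map_add, AddMonoidAlgebra.coeff_add, map_add, add_sub_add_comm]
        exact I.add_mem hf hg
    have := key f
    rw [RingHom.mem_ker] at hf
    simpa [hf] using this
  · rw [Ideal.span_le]
    rintro _ ⟨v, w, h, rfl⟩
    simp [RingHom.mem_ker, monomialMap_monomial, h]

theorem algebraicIndependent_single_iff [Nontrivial R] (a : σ → G) :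
    AlgebraicIndependent R (fun j => (AddMonoidAlgebra.single (a j) 1 : AddMonoidAlgebra R G)) ↔
      LinearIndependent ℕ a := by
  change Function.Injective (monomialMap R a) ↔ Function.Injective (Finsupp.linearCombination ℕ a)
  constructor
  · intro h v w hvw
    have := @h (monomial v 1) (monomial w 1) (by simp [monomialMap_monomial, hvw])
    exact (monomial_left_injective one_ne_zero) this
  · intro h
    rw [injective_iff_map_eq_zero]
    intro f hf
    have : f ∈ RingHom.ker (monomialMap R a) := hf
    rw [ker_monomialMap, Ideal.span_eq_bot.mpr] at this
    · simpa using this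
    · rintro _ ⟨v, w, hvw, rfl⟩
      rw [h hvw, sub_self]

/-- An integer relation is the difference of its positive and negative parts, so independence over
`ℕ`, the injectivity on exponent vectors, is independence over `ℤ`. -/
theorem linearIndependent_int_iff_nat (a : σ → G) :
    LinearIndependent ℤ a ↔ LinearIndependent ℕ a := by
  constructor
  · intro h
    exact h.restrict_scalars' ℕ
  · intro h
    rw [linearIndependent_iff]
    intro l hl
    let v : σ →₀ ℕ := l.mapRange Int.toNat rfl
    let w : σ →₀ ℕ := (-l).mapRange Int.toNat rfl
    have hlv : l = v.mapRange (Nat.cast : ℕ → ℤ) rfl - w.mapRange (Nat.cast : ℕ → ℤ) rfl := by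
      ext i
      simp [v, w]
    have hc (x : σ →₀ ℕ) : Finsupp.linearCombination ℤ a (x.mapRange (Nat.cast : ℕ → ℤ) rfl) =
        Finsupp.linearCombination ℕ a x := by
      simp [Finsupp.linearCombination_apply, Finsupp.sum_mapRange_index]
    have : v = w := by
      apply h
      rw [hlv, map_sub, hc, hc] at hl
      exact sub_eq_zero.mp hl
    rw [hlv, this, sub_self]

end ToricKernel

/-! ### Krull dimension and transcendence degree -/

section KrullDimension

theorem ringKrullDim_eq_of_isIntegral (R S : Type*) [CommRing R] [CommRing S] [Algebra R S]
    [Algebra.IsIntegral R S] [FaithfulSMul R S] : ringKrullDim S = ringKrullDim R := by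
  apply le_antisymm
  · refine Order.krullDim_le_of_strictMono (PrimeSpectrum.comap (algebraMap R S)) ?_
    intro P Q hPQ
    exact Ideal.IsIntegral.comap_lt_comap (R := R) (I := P.asIdeal) (J := Q.asIdeal) hPQ
  · refine iSup_le fun l => ?_
    obtain ⟨Q, -, hQ, hQP⟩ := Ideal.exists_ideal_over_prime_of_isIntegral (S := S)
      l.head.asIdeal ⊥ (by
        rw [← RingHom.ker_eq_comap_bot,
          (RingHom.injective_iff_ker_eq_bot _).mp (FaithfulSMul.algebraMap_injective R S)]
        exact bot_le)
    have : Q.LiesOver l.head.asIdeal := ⟨hQP.symm⟩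
    obtain ⟨L, hL, -⟩ := Ideal.exists_ltSeries_of_hasGoingUp (S := S) l Q
    rw [← hL]
    exact Order.LTSeries.length_le_krullDim L

/-- The Krull dimension of a finitely generated domain over a field is its transcendence degree, by
Noether normalization. -/
theorem ringKrullDim_eq_card_of_isTranscendenceBasis {k D ι : Type*} [Field k] [CommRing D]
    [IsDomain D] [Algebra k D] [Algebra.FiniteType k D] [Finite ι] {x : ι → D}
    (hx : IsTranscendenceBasis k x) : ringKrullDim D = (Nat.card ι : ℕ) := by
  obtain ⟨s, g, hg, hint⟩ := exists_integral_inj_algHom_of_fg k D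
  let := g.toRingHom.toAlgebra
  have : IsScalarTower k (MvPolynomial (Fin s) k) D := IsScalarTower.of_algHom g
  have : Algebra.IsIntegral (MvPolynomial (Fin s) k) D := ⟨hint⟩
  have : FaithfulSMul (MvPolynomial (Fin s) k) D :=
    (faithfulSMul_iff_algebraMap_injective _ _).mpr hg
  rw [ringKrullDim_eq_of_isIntegral (MvPolynomial (Fin s) k) D,
    MvPolynomial.ringKrullDim_of_isNoetherianRing, ringKrullDim_eq_zero_of_field, zero_add]
  have h1 := lift_trdeg_add_eq k (MvPolynomial (Fin s) k) D
  rw [trdeg_eq_zero (R := MvPolynomial (Fin s) k) (A := D),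
    MvPolynomial.trdeg_of_isDomain] at h1
  have h2 := hx.lift_cardinalMk_eq_trdeg
  have h3 := congrArg Cardinal.toNat h1
  have h4 := congrArg Cardinal.toNat h2
  simp only [Cardinal.toNat_lift, Cardinal.lift_zero, add_zero] at h3 h4
  rw [← h4] at h3
  congr 1

end KrullDimension

/-! ### The toric ideal and the dimension of its quotient -/

section Quotient

variable {m n : ℕ} (A : Matrix (Fin m) (Fin (n + 1)) ℤ)

theorem linearCombination_col (v : Fin (n + 1) →₀ ℕ) :
    Finsupp.linearCombination ℕ A.col v = A.mulVec (fun j => (v j : ℤ)) := by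
  ext i
  rw [Finsupp.linearCombination_apply, Finsupp.sum_fintype _ _ (by simp), Matrix.mulVec, dotProduct,
    Finset.sum_apply]
  simp [mul_comm]

theorem prod_X_pow_eq_monomial_one (v : Fin (n + 1) → ℕ) :
    (∏ j, X j ^ v j : PRing n) = monomial (Finsupp.equivFunOnFinite.symm v) 1 := by
  rw [monomial_eq, C_1, one_mul, Finsupp.prod_fintype _ _ (by simp)]
  simp

theorem toricIdeal_eq_ker : toricIdeal A = RingHom.ker (monomialMap ℂ A.col) := by
  rw [ker_monomialMap, toricIdeal]
  congr 1
  ext f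
  constructor
  · rintro ⟨v, w, h, rfl⟩
    refine ⟨Finsupp.equivFunOnFinite.symm v, Finsupp.equivFunOnFinite.symm w, ?_, ?_⟩
    · simpa [linearCombination_col] using h
    · simp [prod_X_pow_eq_monomial_one]
  · rintro ⟨v, w, h, rfl⟩
    refine ⟨v, w, ?_, ?_⟩
    · simpa [linearCombination_col] using h
    · simp [prod_X_pow_eq_monomial_one]

/-- An integer vector in the kernel of `A` is the exponent difference of a binomial in the toric
ideal. -/
theorem exists_binomial_mem_toricIdeal {k : Fin (n + 1) → ℤ} (hk : A.mulVec k = 0) :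
    ∃ v w : Fin (n + 1) → ℕ, k = (fun i => (v i : ℤ)) - (fun i => (w i : ℤ)) ∧
      (∏ j, X j ^ v j - ∏ j, X j ^ w j : PRing n) ∈ toricIdeal A := by
  have hk' : k = (fun i => ((k i).toNat : ℤ)) - fun i => ((-k i).toNat : ℤ) := by
    ext i
    simp
  refine ⟨_, _, hk', Ideal.subset_span ⟨_, _, ?_, rfl⟩⟩
  rw [hk', Matrix.mulVec_sub, sub_eq_zero] at hk
  exact hk

instance isPrime_toricIdeal : (toricIdeal A).IsPrime := by
  rw [toricIdeal_eq_ker]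
  exact RingHom.ker_isPrime _

/-- The quotient by the toric ideal embeds in the Laurent ring, where monomials are algebraically
independent exactly when their exponents are linearly independent. Transcendence bases made of
variables are thus the same as bases of the column space of `A`. -/
theorem ringKrullDim_quotient_toricIdeal :
    ringKrullDim (PRing n ⧸ toricIdeal A) = ((A.map (Int.cast : ℤ → ℂ)).rank : ℕ) := by
  have hker : ∀ a ∈ toricIdeal A, monomialMap ℂ A.col a = 0 := fun a ha => by
    rwa [toricIdeal_eq_ker] at ha
  let ι : (PRing n ⧸ toricIdeal A) →ₐ[ℂ] AddMonoidAlgebra ℂ (Fin m → ℤ) :=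
    Ideal.Quotient.liftₐ (toricIdeal A) (monomialMap ℂ A.col) hker
  have hι : Function.Injective ι := by
    rw [injective_iff_map_eq_zero]
    intro a ha
    obtain ⟨a, rfl⟩ := Ideal.Quotient.mk_surjective a
    rw [Ideal.Quotient.eq_zero_iff_mem, toricIdeal_eq_ker]
    exact ha
  let x : Fin (n + 1) → PRing n ⧸ toricIdeal A := fun j => Ideal.Quotient.mk _ (X j)
  have hιx (j) : ι (x j) = AddMonoidAlgebra.single (A.col j) 1 := by
    change monomialMap ℂ A.col (X j) = _
    simp [monomialMap]
  have hind {κ : Type} (σ : κ → Fin (n + 1)) :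
      AlgebraicIndependent ℂ (x ∘ σ) ↔
        LinearIndependent ℂ ((A.map (Int.cast : ℤ → ℂ)).col ∘ σ) := by
    have h1 : ι ∘ (x ∘ σ) = fun i => AddMonoidAlgebra.single ((A.col ∘ σ) i) (1 : ℂ) := by
      ext1 i; exact hιx _
    rw [← AlgHom.algebraicIndependent_iff ι hι, h1, algebraicIndependent_single_iff,
      ← linearIndependent_int_iff_nat, ← linearIndependent_algebraMap_comp_iff (S := ℂ)]
    rfl
  have hadj : Algebra.adjoin ℂ (Set.range x) = ⊤ := by
    have : Set.range x = Ideal.Quotient.mkₐ ℂ (toricIdeal A) '' Set.range X := by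
      rw [← Set.range_comp]; rfl
    rw [this, ← AlgHom.map_adjoin, MvPolynomial.adjoin_range_X, Algebra.map_top,
      AlgHom.range_eq_top]
    exact Ideal.Quotient.mkₐ_surjective ℂ _
  have : Algebra.IsAlgebraic (Algebra.adjoin ℂ (Set.range x)) (PRing n ⧸ toricIdeal A) := by
    refine ⟨fun y => ?_⟩
    exact isAlgebraic_algebraMap (⟨y, by rw [hadj]; trivial⟩ : Algebra.adjoin ℂ (Set.range x))
  obtain ⟨t, htx, ht⟩ := exists_isTranscendenceBasis_subset (R := ℂ) (Set.range x)
  have : Finite t := (Set.finite_range x).subset htx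
  rw [ringKrullDim_eq_card_of_isTranscendenceBasis ht]
  choose σ hσ using fun y : t => htx y.2
  have hxσ : x ∘ σ = ((↑) : t → PRing n ⧸ toricIdeal A) := funext hσ
  congr 1
  apply le_antisymm
  · have hli := (hind σ).mp (hxσ ▸ ht.1)
    have := Fintype.ofFinite t
    rw [Matrix.rank_eq_finrank_span_cols, Nat.card_eq_fintype_card,
      ← finrank_span_eq_card hli]
    exact Submodule.finrank_mono (Submodule.span_mono (Set.range_comp_subset_range _ _))
  · -- A basis among the columns; its indices give algebraically independent variables.
    obtain ⟨b, hb, hspan, hli⟩ :=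
      exists_linearIndependent ℂ (Set.range (A.map (Int.cast : ℤ → ℂ)).col)
    choose τ hτ using fun y : b => hb y.2
    have hcτ : (A.map (Int.cast : ℤ → ℂ)).col ∘ τ = ((↑) : b → _) := funext hτ
    have hτinj : Function.Injective τ := fun y z h => by
      apply Subtype.ext; rw [← hτ y, ← hτ z, h]
    have : Finite b := Finite.of_injective τ hτinj
    have := Fintype.ofFinite b
    have hal : AlgebraicIndependent ℂ
        (x ∘ fun e : Set.range τ => (e : Fin (n + 1))) := by
      rw [hind]
      have h2 : LinearIndependent ℂ ((A.map (Int.cast : ℤ → ℂ)).col ∘ τ) := by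
        rw [hcτ]; exact hli
      exact (linearIndependent_equiv' (Equiv.ofInjective τ hτinj) rfl).mp h2
    have hle := hal.lift_cardinalMk_le_trdeg
    rw [← ht.lift_cardinalMk_eq_trdeg] at hle
    have hc : Nat.card (Set.range τ) ≤ Nat.card t := by
      have := Cardinal.toNat_le_toNat hle (by simp)
      rwa [Cardinal.toNat_lift, Cardinal.toNat_lift] at this
    rw [Matrix.rank_eq_finrank_span_cols, ← hspan, finrank_span_set_eq_card hli]
    rw [Nat.card_congr (Equiv.ofInjective τ hτinj).symm, Nat.card_eq_fintype_card] at hc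
    rwa [Set.toFinset_card]

end Quotient

/-! ### The vanishing ideal of a toric model -/

section VanishingIdeal

variable {m n : ℕ} (A : Matrix (Fin m) (Fin (n + 1)) ℤ)

/-- The character `θ ↦ ∏ i, θ i ^ b i` of the torus `(ℂ^*)^m`, as a monoid homomorphism to `ℂ`. -/
noncomputable def torusCharacter (b : Fin m → ℤ) : (Fin m → ℂˣ) →* ℂ where
  toFun θ := ((∏ i, θ i ^ b i : ℂˣ) : ℂ)
  map_one' := by simp
  map_mul' θ η := by simp [mul_zpow, Finset.prod_mul_distrib]

theorem torusCharacter_injective : Function.Injective (torusCharacter (m := m)) := by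
  intro b c h
  ext i
  -- The torus point with `i`-th coordinate `2` and all others `1` detects the exponent at `i`.
  have := DFunLike.congr_fun h (Function.update (1 : Fin m → ℂˣ) i (Units.mk0 (2 : ℂ) two_ne_zero))
  simp only [torusCharacter, MonoidHom.coe_mk, OneHom.coe_mk, Units.val_inj] at this
  rw [Finset.prod_eq_single i (by intro j _ hj; simp [hj]) (by simp),
    Finset.prod_eq_single i (by intro j _ hj; simp [hj]) (by simp)] at this
  have h2 := congrArg (fun z : ℂˣ => ‖(z : ℂ)‖) this
  simp only [Function.update_self, Units.val_zpow_eq_zpow_val, Units.val_mk0, norm_zpow,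
    Complex.norm_ofNat] at h2
  exact zpow_right_injective₀ (by norm_num) (by norm_num) h2

theorem linearIndependent_torusCharacter :
    LinearIndependent ℂ (fun b : Fin m → ℤ => (torusCharacter b : (Fin m → ℂˣ) → ℂ)) :=
  (linearIndependent_monoidHom (Fin m → ℂˣ) ℂ).comp torusCharacter torusCharacter_injective

theorem eval_monomialVector (f : PRing n) :
    (fun θ => eval (monomialVector A θ) f) =
      Finsupp.linearCombination ℂ (fun b : Fin m → ℤ => (torusCharacter b : (Fin m → ℂˣ) → ℂ))
        (monomialMap ℂ A.col f).coeff := by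
  induction f using MvPolynomial.induction_on' with
  | monomial v c =>
    rw [monomialMap_monomial, AddMonoidAlgebra.coeff_single, Finsupp.linearCombination_single]
    ext θ
    rw [eval_monomial, Finsupp.prod_fintype _ _ (by simp), Pi.smul_apply, smul_eq_mul,
      linearCombination_col]
    congr 1
    simp only [monomialVector, torusCharacter, MonoidHom.coe_mk, OneHom.coe_mk]
    have h : ∏ j, (∏ i, θ i ^ A i j) ^ v j =
        ∏ i, θ i ^ A.mulVec (fun j => (v j : ℤ)) i := by
      simp only [Matrix.mulVec, dotProduct, ← Finset.prod_pow]
      rw [Finset.prod_comm]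
      refine Finset.prod_congr rfl fun i _ => ?_
      simp only [← zpow_natCast, ← zpow_mul]
      exact (map_sum (zpowersHom ℂˣ (θ i)).toAdditiveRight _ _).symm
    rw [← h]
    simp
  | add f g hf hg =>
    rw [map_add, AddMonoidAlgebra.coeff_add, map_add, ← hf, ← hg]
    ext θ
    simp

/-- The toric ideal is the vanishing ideal of the torus orbit in affine space, by linear independence
of the characters of the torus. -/
theorem mem_toricIdeal_iff (f : PRing n) :
    f ∈ toricIdeal A ↔ ∀ θ, eval (monomialVector A θ) f = 0 := by
  rw [toricIdeal_eq_ker, RingHom.mem_ker]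
  constructor
  · intro h θ
    have := congrFun (eval_monomialVector A f) θ
    rw [h] at this
    simpa using this
  · intro h
    have h1 := eval_monomialVector A f
    rw [funext h] at h1
    have h2 := linearIndependent_torusCharacter (h1.symm.trans (map_zero _).symm)
    exact AddMonoidAlgebra.coeff_injective h2

theorem eval_smul_of_isHomogeneous {σ : Type*} {f : MvPolynomial σ ℂ} {d : ℕ}
    (hf : f.IsHomogeneous d) (c : ℂ) (q : σ → ℂ) : eval (c • q) f = c ^ d * eval q f := by
  rw [eval_eq, eval_eq, Finset.mul_sum]
  refine Finset.sum_congr rfl fun v hv => ?_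
  have : v.degree = d := by
    rw [← hf (mem_support_iff.mp hv), Finsupp.degree_eq_weight_one]
    rfl
  simp only [Pi.smul_apply, smul_eq_mul, mul_pow, Finset.prod_mul_distrib,
    Finset.prod_pow_eq_pow_sum]
  rw [← this, Finsupp.degree_apply]
  ring

variable {A}

theorem vanishingIdeal_range_eq
    (hhom : ∀ f ∈ toricIdeal A, ∀ d : ℕ, homogeneousComponent d f ∈ toricIdeal A) :
    vanishingIdeal (Set.range fun θ : Fin m → ℂˣ =>
      Projectivization.mk ℂ (monomialVector A θ) (monomialVector_ne_zero A θ)) =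
      toricIdeal A := by
  apply le_antisymm
  · intro f hf
    rw [mem_toricIdeal_iff]
    exact fun θ => hf _ ⟨θ, rfl⟩ _ _ rfl
  · rintro f hf _ ⟨θ, rfl⟩ p hp h
    obtain ⟨c, rfl⟩ := (Projectivization.mk_eq_mk_iff' _ _ _ _ _).mp h
    rw [← sum_homogeneousComponent f, map_sum]
    refine Finset.sum_eq_zero fun d _ => ?_
    rw [eval_smul_of_isHomogeneous (homogeneousComponent_isHomogeneous d f),
      (mem_toricIdeal_iff A _).mp (hhom f hf d) θ, mul_zero]

theorem vanishingIdeal_toricModel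
    (hhom : ∀ f ∈ toricIdeal A, ∀ d : ℕ, homogeneousComponent d f ∈ toricIdeal A) :
    vanishingIdeal (toricModel A) = toricIdeal A := by
  apply le_antisymm
  · rw [← vanishingIdeal_range_eq hhom]
    exact fun f hf x hx => hf x fun g hg => hg x hx
  · intro f hf x hx
    rw [← vanishingIdeal_range_eq hhom] at hf
    exact hx f hf

theorem eval_eq_zero_of_mem_toricModel
    (hhom : ∀ f ∈ toricIdeal A, ∀ d : ℕ, homogeneousComponent d f ∈ toricIdeal A)
    {p : Fin (n + 1) → ℂ} {hp : p ≠ 0}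
    (h : Projectivization.mk ℂ p hp ∈ toricModel A) {f : PRing n} (hf : f ∈ toricIdeal A) :
    eval p f = 0 := by
  rw [← vanishingIdeal_range_eq hhom] at hf
  exact h f hf p hp rfl

/-- If the toric ideal is homogeneous, every binomial in it is homogeneous, since no monomial lies
in it: monomials do not vanish at `(1, …, 1)`. -/
theorem sum_eq_zero_of_mulVec_eq_zero
    (hhom : ∀ f ∈ toricIdeal A, ∀ d : ℕ, homogeneousComponent d f ∈ toricIdeal A)
    (k : Fin (n + 1) → ℤ) (hk : A.mulVec k = 0) :
    ∑ i, k i = 0 := by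
  obtain ⟨v, w, hkv, hf⟩ := exists_binomial_mem_toricIdeal A hk
  by_contra hne
  have hvw : ∑ i, v i ≠ ∑ i, w i := by
    intro h
    apply hne
    rw [hkv]
    simp only [Pi.sub_apply, Finset.sum_sub_distrib]
    rw [← Nat.cast_sum, ← Nat.cast_sum, h, sub_self]
  have hX (v : Fin (n + 1) → ℕ) : (∏ j, X j ^ v j : PRing n).IsHomogeneous (∑ i, v i) :=
    IsHomogeneous.prod _ _ _ fun i _ => by simpa using (isHomogeneous_X ℂ i).pow (v i)
  have h1 := hhom _ hf (∑ i, v i)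
  rw [map_sub, homogeneousComponent_of_mem (hX v), homogeneousComponent_of_mem (hX w), if_pos rfl,
    if_neg hvw, sub_zero, mem_toricIdeal_iff] at h1
  simpa [monomialVector] using h1 1

/-- Homogeneity of the toric ideal means that `(1, …, 1)` lies in the row space of `A`. -/
theorem exists_transpose_mulVec_eq_one
    (hhom : ∀ f ∈ toricIdeal A, ∀ d : ℕ, homogeneousComponent d f ∈ toricIdeal A) :
    ∃ y : Fin m → ℂ, (A.map (Int.cast : ℤ → ℂ)).transpose.mulVec y = fun _ => 1 := by
  obtain ⟨y, hy⟩ := mem_range_transpose_of_orthogonal A (fun _ => 1) (fun k hk => by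
    have := sum_eq_zero_of_mulVec_eq_zero hhom k hk
    simpa using congrArg (Int.cast : ℤ → ℂ) this)
  exact ⟨y, hy.symm⟩

end VanishingIdeal

/-! ### Tangent spaces, smooth points and critical points -/

section TangentSpace

variable {m n : ℕ} {A : Matrix (Fin m) (Fin (n + 1)) ℤ}

theorem eval_pderiv_prod_X_pow (v : Fin (n + 1) → ℕ) {p : Fin (n + 1) → ℂ} (hp : ∀ i, p i ≠ 0)
    (i : Fin (n + 1)) :
    eval p (pderiv i (∏ j, X j ^ v j : PRing n)) = v i * (∏ j, p j ^ v j) / p i := by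
  rw [eq_div_iff (hp i), mul_comm, prod_X_pow_eq_monomial_one]
  have := congrArg (eval p) (X_mul_pderiv_monomial (i := i)
    (m := Finsupp.equivFunOnFinite.symm v) (r := (1 : ℂ)))
  rw [map_mul, eval_X] at this
  rw [this, ← prod_X_pow_eq_monomial_one]
  simp

/-- At a point `p` of the cone with nonzero coordinates, the tangent space is `diag(p)` applied to the
row space of `A`: the logarithmic differential of the binomial with exponents `v`, `w` is `v - w`. -/
theorem mem_tangentSpace_iff
    (hhom : ∀ f ∈ toricIdeal A, ∀ d : ℕ, homogeneousComponent d f ∈ toricIdeal A)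
    {p : Fin (n + 1) → ℂ} (hp : ∀ i, p i ≠ 0) (hpA : ∀ f ∈ toricIdeal A, eval p f = 0)
    (x : Fin (n + 1) → ℂ) :
    x ∈ tangentSpace (toricModel A) p ↔
      ∃ y, x = (Matrix.diagonal p * (A.map (Int.cast : ℤ → ℂ)).transpose).mulVec y := by
  change (∀ f ∈ vanishingIdeal (toricModel A), ∑ i, eval p (pderiv i f) * x i = 0) ↔ _
  rw [vanishingIdeal_toricModel hhom]
  constructor
  · intro h
    obtain ⟨y, hy⟩ := mem_range_transpose_of_orthogonal A (fun i => x i / p i) (fun k hk => by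
      obtain ⟨v, w, hkv, hf⟩ := exists_binomial_mem_toricIdeal A hk
      have h1 := h _ hf
      have h2 := hpA _ hf
      simp only [map_sub, map_prod, map_pow, eval_X, sub_eq_zero] at h2
      simp only [map_sub, eval_pderiv_prod_X_pow _ hp, ← h2] at h1
      have hP : ∏ j, p j ^ v j ≠ 0 := Finset.prod_ne_zero_iff.mpr fun j _ => pow_ne_zero _ (hp j)
      refine (mul_eq_zero.mp (?_ : (∏ j, p j ^ v j) * _ = 0)).resolve_left hP
      rw [← h1, Finset.mul_sum]
      refine Finset.sum_congr rfl fun i _ => ?_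
      rw [hkv]
      simp only [Pi.sub_apply, Int.cast_sub, Int.cast_natCast]
      ring)
    refine ⟨y, ?_⟩
    ext i
    rw [← Matrix.mulVec_mulVec, Matrix.mulVec_diagonal, ← hy, mul_div_cancel₀ _ (hp i)]
  · rintro ⟨y, rfl⟩ f hf
    -- The Leibniz rule needs `f` itself to vanish at `p`, so this is carried along.
    have key : eval p f = 0 ∧ ∑ i, eval p (pderiv i f) *
        (Matrix.diagonal p * (A.map (Int.cast : ℤ → ℂ)).transpose).mulVec y i = 0 := by
      refine Submodule.span_induction ?_ ?_ ?_ ?_ hf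
      · rintro _ ⟨v, w, hvw, rfl⟩
        have h2 := hpA _ (Ideal.subset_span ⟨v, w, hvw, rfl⟩)
        refine ⟨h2, ?_⟩
        simp only [map_sub, map_prod, map_pow, eval_X, sub_eq_zero] at h2
        have hterm (i : Fin (n + 1)) : eval p (pderiv i (∏ j, X j ^ v j - ∏ j, X j ^ w j)) *
            (Matrix.diagonal p * (A.map (Int.cast : ℤ → ℂ)).transpose).mulVec y i =
            (∏ j, p j ^ v j) * ((A.map (Int.cast : ℤ → ℂ)).transpose.mulVec y i *
              ((v i : ℂ) - w i)) := by
          rw [map_sub, map_sub, eval_pderiv_prod_X_pow _ hp, eval_pderiv_prod_X_pow _ hp, ← h2,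
            ← Matrix.mulVec_mulVec, Matrix.mulVec_diagonal]
          field_simp [hp i]
        rw [Finset.sum_congr rfl fun i _ => hterm i, ← Finset.mul_sum]
        refine mul_eq_zero_of_right _ ?_
        change dotProduct ((A.map (Int.cast : ℤ → ℂ)).transpose.mulVec y)
          (fun i => (v i : ℂ) - w i) = 0
        rw [Matrix.mulVec_transpose, ← Matrix.dotProduct_mulVec]
        convert dotProduct_zero y
        ext i
        have h3 := congrArg (Int.cast : ℤ → ℂ) (congrFun hvw i)
        simp only [Matrix.mulVec, dotProduct, Int.cast_sum, Int.cast_mul, Int.cast_natCast] at h3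
        simp only [Matrix.mulVec, dotProduct, Matrix.map_apply, mul_sub, Finset.sum_sub_distrib,
          h3, sub_self, Pi.zero_apply]
      · simp
      · rintro f g - - ⟨hf1, hf2⟩ ⟨hg1, hg2⟩
        simp only [map_add, hf1, hg1, add_mul, Finset.sum_add_distrib, hf2, hg2]
        simp
      · rintro c f - ⟨hf1, hf2⟩
        refine ⟨by simp [hf1], ?_⟩
        simp only [smul_eq_mul, Derivation.leibniz, map_add, map_mul, hf1, zero_mul, add_zero,
          mul_assoc, ← Finset.mul_sum, hf2, mul_zero]
    exact key.2

/-- All points of a toric model off the coordinate hyperplanes are smooth: the tangent space there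
has dimension the rank of `A`, which is the dimension of the cone. -/
theorem mem_regularLocus_toricModel
    (hhom : ∀ f ∈ toricIdeal A, ∀ d : ℕ, homogeneousComponent d f ∈ toricIdeal A)
    {p : Fin (n + 1) → ℂ} (hp0 : p ≠ 0) (hp : ∀ i, p i ≠ 0)
    (hpM : Projectivization.mk ℂ p hp0 ∈ toricModel A) :
    Projectivization.mk ℂ p hp0 ∈ regularLocus (toricModel A) := by
  refine ⟨hpM, p, hp0, rfl, ?_⟩
  have hT : tangentSpace (toricModel A) p =
      LinearMap.range (Matrix.diagonal p * (A.map (Int.cast : ℤ → ℂ)).transpose).mulVecLin := by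
    ext x
    rw [mem_tangentSpace_iff hhom hp (fun f hf => eval_eq_zero_of_mem_toricModel hhom hpM hf)]
    exact exists_congr fun y => eq_comm
  rw [vanishingIdeal_toricModel hhom, ringKrullDim_quotient_toricIdeal, hT]
  change ((Matrix.rank _ : ℕ) : WithBot ℕ∞) = _
  rw [Matrix.rank_mul_eq_right_of_isUnit_det, Matrix.rank_transpose]
  rw [Matrix.det_diagonal, isUnit_iff_ne_zero]
  exact Finset.prod_ne_zero_iff.mpr fun i _ => hp i

/-- Pairing `dlog ℓ_u` with the tangent vector `diag(p) Aᵀ y` gives `yᵀ (A u - (u_+ / p_+) A p)`. A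
proportionality factor between `A u` and `A p` is necessarily `u_+ / p_+`, as `(1, …, 1)` is in the
row space of `A`. -/
theorem dlogLikelihood_eq_zero_iff
    (hhom : ∀ f ∈ toricIdeal A, ∀ d : ℕ, homogeneousComponent d f ∈ toricIdeal A)
    {p : Fin (n + 1) → ℂ} (hp : OffHyperplanes p) (hpA : ∀ f ∈ toricIdeal A, eval p f = 0)
    (u : Fin (n + 1) → ℂ) :
    (∀ v ∈ tangentSpace (toricModel A) p, dlogLikelihood u p v = 0) ↔
      ∃ c : ℂ, (A.map (Int.cast : ℤ → ℂ)).mulVec u =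
        c • (A.map (Int.cast : ℤ → ℂ)).mulVec p := by
  set M := A.map (Int.cast : ℤ → ℂ)
  set c := (∑ j, u j) / ∑ j, p j
  have hdlog (y : Fin m → ℂ) :
      dlogLikelihood u p ((Matrix.diagonal p * M.transpose).mulVec y) =
        dotProduct y (M.mulVec u - c • M.mulVec p) := by
    rw [← Matrix.mulVec_smul, ← Matrix.mulVec_sub, Matrix.dotProduct_mulVec,
      ← Matrix.mulVec_transpose, ← Matrix.mulVec_mulVec, dlogLikelihood]
    refine Finset.sum_congr rfl fun i _ => ?_
    rw [Matrix.mulVec_diagonal]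
    have := hp.1 i
    simp only [Pi.sub_apply, Pi.smul_apply, smul_eq_mul]
    field_simp
    ring
  have hall : (∀ v ∈ tangentSpace (toricModel A) p, dlogLikelihood u p v = 0) ↔
      ∀ y, dotProduct y (M.mulVec u - c • M.mulVec p) = 0 := by
    simp only [← hdlog, mem_tangentSpace_iff hhom hp.1 hpA]
    exact ⟨fun h y => h _ ⟨y, rfl⟩, by rintro h _ ⟨y, rfl⟩; exact h y⟩
  rw [hall]
  constructor
  · intro h
    refine ⟨c, sub_eq_zero.mp ?_⟩
    exact dotProduct_eq_zero _ fun y => by rw [dotProduct_comm]; exact h y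
  · rintro ⟨d, hd⟩ y
    obtain ⟨y₁, hy₁⟩ := exists_transpose_mulVec_eq_one hhom
    have hsum (x : Fin (n + 1) → ℂ) : dotProduct y₁ (M.mulVec x) = ∑ j, x j := by
      rw [Matrix.dotProduct_mulVec, ← Matrix.mulVec_transpose, hy₁]
      simp [dotProduct]
    have hcd : c = d := by
      have := congrArg (dotProduct y₁) hd
      rw [dotProduct_smul, hsum, hsum, smul_eq_mul] at this
      exact (div_eq_iff hp.2).mpr this
    rw [hcd, hd, sub_self, dotProduct_zero]

end TangentSpace

/-! ### The critical pairs of a toric model -/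

section Correspondence

variable {m n : ℕ} {A : Matrix (Fin m) (Fin (n + 1)) ℤ}

/-- The critical pairs in terms of arbitrary representatives. All points off the hyperplanes being
smooth, the regularity condition disappears. -/
theorem mem_criticalPairs_iff
    (hhom : ∀ f ∈ toricIdeal A, ∀ d : ℕ, homogeneousComponent d f ∈ toricIdeal A)
    {p u : Fin (n + 1) → ℂ} (hp : p ≠ 0) (hu : u ≠ 0) :
    (Projectivization.mk ℂ p hp, Projectivization.mk ℂ u hu) ∈ criticalPairs (toricModel A) ↔
      Projectivization.mk ℂ p hp ∈ toricModel A ∧ OffHyperplanes p ∧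
        ∃ c : ℂ, (A.map (Int.cast : ℤ → ℂ)).mulVec u =
          c • (A.map (Int.cast : ℤ → ℂ)).mulVec p := by
  constructor
  · rintro ⟨q, w, hq, hw, hz, hreg, hoff, hcrit⟩
    obtain ⟨h1, h2⟩ := Prod.mk.inj hz
    rw [dlogLikelihood_eq_zero_iff hhom hoff
      (fun f hf => eval_eq_zero_of_mem_toricModel hhom hreg.1 hf)] at hcrit
    obtain ⟨c, hc⟩ := hcrit
    refine ⟨h1 ▸ hreg.1, ?_⟩
    obtain ⟨a, rfl⟩ := (Projectivization.mk_eq_mk_iff' _ _ _ _ _).mp h1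
    obtain ⟨b, rfl⟩ := (Projectivization.mk_eq_mk_iff' _ _ _ _ _).mp h2
    have ha : a ≠ 0 := fun h => hp (by rw [h, zero_smul])
    refine ⟨⟨fun i => mul_ne_zero ha (hoff.1 i), ?_⟩, b * c / a, ?_⟩
    · simp only [Pi.smul_apply, smul_eq_mul, ← Finset.mul_sum]
      exact mul_ne_zero ha hoff.2
    · rw [Matrix.mulVec_smul, Matrix.mulVec_smul, hc, smul_smul, smul_smul, div_mul_cancel₀ _ ha]
  · rintro ⟨hM, hoff, hc⟩
    refine ⟨p, u, hp, hu, rfl, mem_regularLocus_toricModel hhom hp hoff.1 hM, hoff, ?_⟩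
    rwa [dlogLikelihood_eq_zero_iff hhom hoff
      (fun f hf => eval_eq_zero_of_mem_toricModel hhom hM hf)]

theorem vanishingIdeal₂_zariskiClosure₂ (S : Set (PSpace n × PSpace n)) :
    vanishingIdeal₂ (zariskiClosure₂ S) = vanishingIdeal₂ S := by
  apply le_antisymm
  · exact fun f hf z hz => hf z fun g hg => hg z hz
  · exact fun f hf z hz => hz f hf

end Correspondence

/-! ### The determinantal equations -/

section Equations

variable {m n : ℕ} (A : Matrix (Fin m) (Fin (n + 1)) ℤ)

theorem eval_mul_dataMatrix_zero (p u : Fin (n + 1) → ℂ) (i : Fin m) :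
    eval (Sum.elim p u) ((A.map (Int.cast : ℤ → PURing n) * dataMatrix n) i 0) =
      (A.map (Int.cast : ℤ → ℂ)).mulVec u i := by
  simp [Matrix.mul_apply, dataMatrix, Matrix.mulVec, dotProduct]

theorem eval_mul_dataMatrix_one (p u : Fin (n + 1) → ℂ) (i : Fin m) :
    eval (Sum.elim p u) ((A.map (Int.cast : ℤ → PURing n) * dataMatrix n) i 1) =
      (A.map (Int.cast : ℤ → ℂ)).mulVec p i := by
  simp [Matrix.mul_apply, dataMatrix, Matrix.mulVec, dotProduct]

/-- The polynomial `p_+ (A u)_i - u_+ (A p)_i`, linear in `u`. -/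
noncomputable def momentEquation (i : Fin m) : PURing n :=
  (∑ j, X (Sum.inl j)) * (A.map (Int.cast : ℤ → PURing n) * dataMatrix n) i 0 -
    (∑ j, X (Sum.inr j)) * (A.map (Int.cast : ℤ → PURing n) * dataMatrix n) i 1

theorem eval_momentEquation (p u : Fin (n + 1) → ℂ) (i : Fin m) :
    eval (Sum.elim p u) (momentEquation A i) =
      (∑ j, p j) * (A.map (Int.cast : ℤ → ℂ)).mulVec u i -
        (∑ j, u j) * (A.map (Int.cast : ℤ → ℂ)).mulVec p i := by
  rw [momentEquation, map_sub, map_mul, map_mul, eval_mul_dataMatrix_zero, eval_mul_dataMatrix_one]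
  simp

variable {A}

/-- A combination of the rows of `A` equal to `(1, …, 1)` turns the minors of `A M` into the moment
equations. -/
theorem momentEquation_mem_minorsIdeal
    (hhom : ∀ f ∈ toricIdeal A, ∀ d : ℕ, homogeneousComponent d f ∈ toricIdeal A) (i : Fin m) :
    momentEquation A i ∈ minorsIdeal 2 (A.map (Int.cast : ℤ → PURing n) * dataMatrix n) := by
  obtain ⟨y, hy⟩ := exists_transpose_mulVec_eq_one hhom
  set N := A.map (Int.cast : ℤ → PURing n) * dataMatrix n with hN
  have hcol (c : Fin 2) : ∑ k, C (y k) * N k c = ∑ j, dataMatrix n j c := by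
    have hy' (j : Fin (n + 1)) : ∑ k, C (y k) * ((A k j : ℤ) : PURing n) = 1 := by
      have h1 := congrArg (C : ℂ → PURing n) (congrFun hy j)
      simp only [Matrix.mulVec, dotProduct, Matrix.transpose_apply, Matrix.map_apply, map_sum,
        map_mul, map_intCast, map_one] at h1
      rw [← h1]
      exact Finset.sum_congr rfl fun k _ => mul_comm _ _
    simp only [hN, Matrix.mul_apply, Finset.mul_sum]
    rw [Finset.sum_comm]
    refine Finset.sum_congr rfl fun j _ => ?_
    simp only [Matrix.map_apply, ← mul_assoc, ← Finset.sum_mul]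
    rw [hy' j, one_mul]
  have h0 := hcol 0
  have h1 := hcol 1
  simp only [dataMatrix, Matrix.of_apply, Matrix.cons_val_zero, Matrix.cons_val_one] at h0 h1
  have : momentEquation A i = ∑ k, C (y k) * (N i 0 * N k 1 - N i 1 * N k 0) := by
    rw [momentEquation, ← h0, ← h1, Finset.sum_mul, Finset.sum_mul, ← Finset.sum_sub_distrib]
    exact Finset.sum_congr rfl fun k _ => by ring
  rw [this]
  refine Ideal.sum_mem _ fun k _ => Ideal.mul_mem_left _ _ (Ideal.subset_span ?_)
  refine ⟨![i, k], ![0, 1], ?_⟩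
  rw [Matrix.det_fin_two]
  rfl

theorem eval_eq_zero_of_mem_toricIdeal_add_minorsIdeal {p u : Fin (n + 1) → ℂ}
    (hpA : ∀ f ∈ toricIdeal A, eval p f = 0) {c : ℂ}
    (hc : (A.map (Int.cast : ℤ → ℂ)).mulVec u = c • (A.map (Int.cast : ℤ → ℂ)).mulVec p)
    {f : PURing n}
    (hf : f ∈ (toricIdeal A).map (rename Sum.inl : PRing n →ₐ[ℂ] PURing n) +
      minorsIdeal 2 (A.map (Int.cast : ℤ → PURing n) * dataMatrix n)) :
    eval (Sum.elim p u) f = 0 := by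
  suffices h : (toricIdeal A).map (rename Sum.inl : PRing n →ₐ[ℂ] PURing n) +
      minorsIdeal 2 (A.map (Int.cast : ℤ → PURing n) * dataMatrix n) ≤
      RingHom.ker (eval (Sum.elim p u)) from h hf
  rw [Submodule.add_eq_sup]
  refine sup_le (Ideal.map_le_iff_le_comap.mpr fun g hg => ?_) (Ideal.span_le.mpr ?_)
  · rw [Ideal.mem_comap, RingHom.mem_ker, eval_rename, Sum.elim_comp_inl]
    exact hpA g hg
  · rintro _ ⟨r, s, rfl⟩
    have hentry (k : Fin m) (j : Fin 2) :
        eval (Sum.elim p u) ((A.map (Int.cast : ℤ → PURing n) * dataMatrix n) k j) =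
          ![c, 1] j * (A.map (Int.cast : ℤ → ℂ)).mulVec p k := by
      fin_cases j
      · exact (eval_mul_dataMatrix_zero A p u k).trans (by rw [hc]; rfl)
      · exact (eval_mul_dataMatrix_one A p u k).trans (by simp)
    rw [SetLike.mem_coe, RingHom.mem_ker, Matrix.det_fin_two]
    simp only [Matrix.submatrix_apply, map_sub, map_mul, hentry]
    ring

end Equations

/-! ### The saturated ideal is the vanishing ideal -/

section Saturation

variable {m n : ℕ} {A : Matrix (Fin m) (Fin (n + 1)) ℤ}

theorem mem_saturation_span_singleton_iff {R : Type*} [CommRing R] (I : Ideal R) (h f : R) :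
    f ∈ saturation I (Ideal.span {h}) ↔ ∃ k : ℕ, f * h ^ k ∈ I := by
  refine exists_congr fun k => ?_
  rw [Ideal.span_singleton_pow]
  constructor
  · exact fun H => H _ (Ideal.mem_span_singleton_self _)
  · intro H g hg
    obtain ⟨q, rfl⟩ := Ideal.mem_span_singleton.mp hg
    rw [← mul_assoc]
    exact I.mul_mem_right _ H

theorem aeval_sub_aeval_mem {σ R S : Type*} [CommRing R] [CommRing S] [Algebra R S] (I : Ideal S)
    (φ ψ : σ → S) (h : ∀ i, φ i - ψ i ∈ I) (f : MvPolynomial σ R) :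
    aeval φ f - aeval ψ f ∈ I := by
  rw [← Ideal.Quotient.eq]
  change (Ideal.Quotient.mkₐ R I) _ = (Ideal.Quotient.mkₐ R I) _
  rw [comp_aeval_apply, comp_aeval_apply]
  congr 2
  ext i
  exact Ideal.Quotient.eq.mpr (h i)

/-- A polynomial in `p` and `u` that vanishes at all `(θ ^ A, u)` lies in the extension of the toric
ideal, because each of its coefficients as a polynomial in `u` does. -/
theorem mem_map_rename_inl_toricIdeal {f : PURing n}
    (hf : ∀ θ u, eval (Sum.elim (monomialVector A θ) u) f = 0) :
    f ∈ (toricIdeal A).map (rename Sum.inl : PRing n →ₐ[ℂ] PURing n) := by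
  let e : PURing n ≃ₐ[ℂ] MvPolynomial (Fin (n + 1)) (PRing n) :=
    (renameEquiv ℂ (Equiv.sumComm _ _)).trans (sumAlgEquiv ℂ _ _)
  have he_inl (j) : e (X (Sum.inl j)) = C (X j) := by simp [e]
  have he_inr (j) : e (X (Sum.inr j)) = X j := by simp [e]
  have heval (p u : Fin (n + 1) → ℂ) (f : PURing n) :
      eval u (MvPolynomial.map (eval p) (e f)) = eval (Sum.elim p u) f := by
    induction f using MvPolynomial.induction_on with
    | C a =>
      have : e (C a) = C (C a) := e.commutes a
      simp [this]
    | add f g hf hg => simp only [map_add, hf, hg]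
    | mul_X f i hf =>
      rw [map_mul, map_mul, map_mul, map_mul, hf]
      rcases i with j | j
      · simp [he_inl]
      · simp [he_inr]
  have hmem : e f ∈ (toricIdeal A).map (C : PRing n →+* _) := by
    rw [mem_map_C_iff]
    intro d
    rw [mem_toricIdeal_iff]
    intro θ
    have : MvPolynomial.map (eval (monomialVector A θ)) (e f) = 0 :=
      MvPolynomial.funext fun u => by rw [heval, hf, map_zero]
    rw [← coeff_map, this, coeff_zero]
  have h2 := Ideal.mem_map_of_mem e.symm.toRingHom hmem
  rw [Ideal.map_map] at h2
  have h3 : (e.symm.toRingHom.comp (C : PRing n →+* _)) =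
      ((rename Sum.inl : PRing n →ₐ[ℂ] PURing n) : PRing n →+* PURing n) := by
    refine MvPolynomial.ringHom_ext (fun a => ?_) fun j => ?_
    · change e.symm (C (C a)) = rename Sum.inl (C a)
      rw [AlgEquiv.symm_apply_eq, rename_C]
      exact (e.commutes a).symm
    · change e.symm (C (X j)) = rename Sum.inl (X j)
      rw [AlgEquiv.symm_apply_eq, rename_X, he_inl]
  rw [h3] at h2
  exact (e.symm_apply_apply f) ▸ h2

/-- The substitution `u ↦ p_+ u`, which fixes the variables `p_j`. -/
noncomputable def scaleData (n : ℕ) : PURing n →ₐ[ℂ] PURing n :=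
  aeval (Sum.elim (fun j => X (Sum.inl j)) fun j => (∑ k, X (Sum.inl k)) * X (Sum.inr j))

theorem eval_scaleData (p u : Fin (n + 1) → ℂ) (f : PURing n) :
    eval (Sum.elim p u) (scaleData n f) = eval (Sum.elim p ((∑ k, p k) • u)) f := by
  rw [scaleData, ← coe_aeval_eq_eval, ← coe_aeval_eq_eval]
  change (aeval _) _ = _
  rw [comp_aeval_apply]
  change _ = (aeval _) f
  congr 2
  ext (j | j) <;> simp

/-- The substitution `u ↦ p_+ u` is invertible up to powers of `p_+`. -/
theorem exists_scaleData_eq (f : PURing n) :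
    ∃ (N : ℕ) (F : PURing n), scaleData n F = (∑ k, X (Sum.inl k)) ^ N * f := by
  have hs : scaleData n (∑ k, X (Sum.inl k)) = ∑ k, X (Sum.inl k) := by
    simp [scaleData]
  induction f using MvPolynomial.induction_on with
  | C a => exact ⟨0, C a, by simp [scaleData]⟩
  | add f g hf hg =>
    obtain ⟨N, F, hF⟩ := hf
    obtain ⟨N', G, hG⟩ := hg
    refine ⟨N + N', (∑ k, X (Sum.inl k)) ^ N' * F + (∑ k, X (Sum.inl k)) ^ N * G, ?_⟩
    rw [map_add, map_mul, map_mul, map_pow, map_pow, hs, hF, hG]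
    ring
  | mul_X f i hf =>
    obtain ⟨N, F, hF⟩ := hf
    rcases i with j | j
    · refine ⟨N, F * X (Sum.inl j), ?_⟩
      rw [map_mul, hF, mul_assoc]
      simp [scaleData]
    · refine ⟨N + 1, F * X (Sum.inr j), ?_⟩
      rw [map_mul, hF]
      simp only [scaleData, aeval_X, Sum.elim_inr]
      ring

/-- Let `F` vanish at all `(p, v)` with `p` in the torus orbit off the hyperplanes and `A v`
proportional to `A p`. With a generalized inverse `G` of `A`, the vector
`w = p_+ u - G A (p_+ u - u_+ p)` satisfies `A w = u_+ A p` on the orbit for every `u`, so `F(p, w)`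
vanishes for all such `p` and all `u`; and `w` is congruent to `p_+ u` modulo the minors. -/
theorem mul_hyperplaneProduct_scaleData_mem
    (hhom : ∀ f ∈ toricIdeal A, ∀ d : ℕ, homogeneousComponent d f ∈ toricIdeal A) {F : PURing n}
    (hF : ∀ θ, OffHyperplanes (monomialVector A θ) → ∀ (v : Fin (n + 1) → ℂ) (c : ℂ),
      (A.map (Int.cast : ℤ → ℂ)).mulVec v =
        c • (A.map (Int.cast : ℤ → ℂ)).mulVec (monomialVector A θ) →
      eval (Sum.elim (monomialVector A θ) v) F = 0) :
    hyperplaneProduct n * scaleData n F ∈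
      (toricIdeal A).map (rename Sum.inl : PRing n →ₐ[ℂ] PURing n) +
        minorsIdeal 2 (A.map (Int.cast : ℤ → PURing n) * dataMatrix n) := by
  obtain ⟨G, hG⟩ := exists_generalized_inverse (A.map (Int.cast : ℤ → ℂ))
  set M := A.map (Int.cast : ℤ → ℂ)
  let w : Fin (n + 1) → PURing n := fun j =>
    (∑ k, X (Sum.inl k)) * X (Sum.inr j) - ∑ i, C (G j i) * momentEquation A i
  let g : PURing n := aeval (Sum.elim (fun j => X (Sum.inl j)) w) F
  have hsub : scaleData n F - g ∈
      minorsIdeal 2 (A.map (Int.cast : ℤ → PURing n) * dataMatrix n) := by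
    refine aeval_sub_aeval_mem _ _ _ ?_ F
    rintro (j | j)
    · simp
    · simp only [Sum.elim_inr, w, sub_sub_cancel]
      exact Ideal.sum_mem _ fun i _ =>
        Ideal.mul_mem_left _ _ (momentEquation_mem_minorsIdeal hhom i)
  have hg : hyperplaneProduct n * g ∈
      (toricIdeal A).map (rename Sum.inl : PRing n →ₐ[ℂ] PURing n) := by
    refine mem_map_rename_inl_toricIdeal fun θ u => ?_
    set p := monomialVector A θ with hp
    rw [map_mul]
    -- On the hyperplane `p_+ = 0` the factor `hyperplaneProduct` vanishes; the coordinates of `p`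
    -- are never zero.
    by_cases hoff : ∑ j, p j = 0
    · rw [hyperplaneProduct, map_mul, map_sum]
      simp [hoff]
    · refine mul_eq_zero_of_right _ ?_
      let v : Fin (n + 1) → ℂ := (∑ k, p k) • u -
        G.mulVec ((∑ k, p k) • M.mulVec u - (∑ k, u k) • M.mulVec p)
      have hgv : eval (Sum.elim p u) g = eval (Sum.elim p v) F := by
        rw [← coe_aeval_eq_eval, ← coe_aeval_eq_eval]
        change (aeval _) _ = aeval _ F
        rw [comp_aeval_apply]
        congr 2
        ext (j | j)
        · simp
        · simp only [Sum.elim_inr, w, v]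
          change eval (Sum.elim p u) _ = _
          simp only [map_sub, map_mul, map_sum, eval_X, eval_C, eval_momentEquation, Sum.elim_inl,
            Sum.elim_inr]
          rfl
      rw [hgv]
      refine hF θ ⟨fun i => Units.ne_zero _, hoff⟩ v (∑ k, u k) ?_
      simp only [v, ← hp]
      rw [← Matrix.mulVec_smul, ← Matrix.mulVec_smul, ← Matrix.mulVec_sub, Matrix.mulVec_sub,
        Matrix.mulVec_mulVec, Matrix.mulVec_mulVec, hG, Matrix.mulVec_sub,
        sub_sub_cancel, Matrix.mulVec_smul]
  have : hyperplaneProduct n * scaleData n F =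
      hyperplaneProduct n * g + hyperplaneProduct n * (scaleData n F - g) := by ring
  rw [this]
  exact Submodule.add_mem_sup hg (Ideal.mul_mem_left _ _ hsub)

/-- Vanishing at the nonzero multiples of `p` gives vanishing at `u = 0`, which is no point of
projective space. -/
theorem eval_eq_zero_of_forall_smul {f : PURing n} {p : Fin (n + 1) → ℂ}
    (h : ∀ t : ℂ, t ≠ 0 → eval (Sum.elim p (t • p)) f = 0) : eval (Sum.elim p 0) f = 0 := by
  let q : Polynomial ℂ := aeval (Sum.elim (fun j => Polynomial.C (p j))
    (fun j => Polynomial.X * Polynomial.C (p j))) f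
  have hq (t : ℂ) : q.eval t = eval (Sum.elim p (t • p)) f := by
    rw [← Polynomial.coe_aeval_eq_eval, ← coe_aeval_eq_eval]
    change (Polynomial.aeval t) (aeval _ f) = aeval _ f
    rw [comp_aeval_apply]
    congr 2
    ext (j | j)
    · simp
    · simpa using mul_comm (p j) t
  -- The factor `X` covers the excluded value `t = 0`.
  have hXq : Polynomial.X * q = 0 := by
    refine Polynomial.funext fun t => ?_
    rw [Polynomial.eval_mul, Polynomial.eval_X, Polynomial.eval_zero]
    by_cases ht : t = 0
    · rw [ht, zero_mul]
    · rw [hq, h t ht, mul_zero]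
  have hq0 : q = 0 := (mul_eq_zero.mp hXq).resolve_left Polynomial.X_ne_zero
  have := hq 0
  rw [hq0, Polynomial.eval_zero, zero_smul] at this
  exact this.symm

theorem toricLikelihoodIdeal_eq
    (hhom : ∀ f ∈ toricIdeal A, ∀ d : ℕ, homogeneousComponent d f ∈ toricIdeal A) :
    toricLikelihoodIdeal A = likelihoodIdeal (toricModel A) := by
  rw [likelihoodIdeal, likelihoodCorrespondence, vanishingIdeal₂_zariskiClosure₂]
  ext f
  rw [toricLikelihoodIdeal, mem_saturation_span_singleton_iff]
  constructor
  · rintro ⟨k, hk⟩ z hz p u hp hu rfl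
    obtain ⟨hM, hoff, c, hc⟩ := (mem_criticalPairs_iff hhom hp hu).mp hz
    have h1 := eval_eq_zero_of_mem_toricIdeal_add_minorsIdeal
      (fun f hf => eval_eq_zero_of_mem_toricModel hhom hM hf) hc hk
    rw [map_mul, map_pow] at h1
    refine (mul_eq_zero.mp h1).resolve_right (pow_ne_zero _ ?_)
    rw [hyperplaneProduct, map_mul, map_prod, map_sum]
    simp only [eval_X, Sum.elim_inl]
    exact mul_ne_zero (Finset.prod_ne_zero_iff.mpr fun i _ => hoff.1 i) hoff.2
  · intro hf
    -- `f` vanishes on the affine cone over the critical pairs, the vectors `u = 0` included.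
    have hzero : ∀ θ, OffHyperplanes (monomialVector A θ) → ∀ (u : Fin (n + 1) → ℂ) (c : ℂ),
        (A.map (Int.cast : ℤ → ℂ)).mulVec u =
          c • (A.map (Int.cast : ℤ → ℂ)).mulVec (monomialVector A θ) →
        eval (Sum.elim (monomialVector A θ) u) f = 0 := by
      intro θ hoff u c hc
      have hM : Projectivization.mk ℂ (monomialVector A θ) (monomialVector_ne_zero A θ) ∈
          toricModel A := fun g hg => hg _ ⟨θ, rfl⟩
      have hne (v : Fin (n + 1) → ℂ) (hv : v ≠ 0) (c : ℂ)
          (hc : (A.map (Int.cast : ℤ → ℂ)).mulVec v =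
            c • (A.map (Int.cast : ℤ → ℂ)).mulVec (monomialVector A θ)) :
          eval (Sum.elim (monomialVector A θ) v) f = 0 :=
        hf _ ((mem_criticalPairs_iff hhom (monomialVector_ne_zero A θ) hv).mpr ⟨hM, hoff, c, hc⟩)
          _ _ _ hv rfl
      by_cases hu : u = 0
      · rw [hu]
        exact eval_eq_zero_of_forall_smul fun t ht =>
          hne _ (smul_ne_zero ht (monomialVector_ne_zero A θ)) t (Matrix.mulVec_smul _ _ _)
      · exact hne u hu c hc
    obtain ⟨N, F, hF⟩ := exists_scaleData_eq f
    have hmem := mul_hyperplaneProduct_scaleData_mem hhom (F := F) fun θ hoff v c hc => by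
      set p := monomialVector A θ
      have hv : v = (∑ k, p k) • ((∑ k, p k)⁻¹ • v) := by
        rw [smul_smul, mul_inv_cancel₀ hoff.2, one_smul]
      rw [hv, ← eval_scaleData, hF, map_mul, hzero θ hoff _ ((∑ k, p k)⁻¹ * c), mul_zero]
      rw [Matrix.mulVec_smul, hc, smul_smul]
    refine ⟨N + 1, ?_⟩
    have : f * hyperplaneProduct n ^ (N + 1) = (∏ j, X (Sum.inl j)) ^ N *
        (hyperplaneProduct n * scaleData n F) := by
      rw [hF, hyperplaneProduct]
      ring
    rw [this]
    exact Ideal.mul_mem_left _ _ hmem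

end Saturation

end LikelihoodGeometry

theorem theorem3p1 {m n : ℕ} (A : Matrix (Fin m) (Fin (n + 1)) ℤ)
    (hA : ∀ j k : Fin (n + 1), ∑ i, A i j = ∑ i, A i k)
    (hhom : ∀ f ∈ LikelihoodGeometry.toricIdeal A, ∀ d : ℕ,
      MvPolynomial.homogeneousComponent d f ∈ LikelihoodGeometry.toricIdeal A) :
    LikelihoodGeometry.toricLikelihoodIdeal A =
        LikelihoodGeometry.likelihoodIdeal (LikelihoodGeometry.toricModel A) ∧
      ∀ (p u : Fin (n + 1) → ℂ) (hp : p ≠ 0) (hu : u ≠ 0),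
        LikelihoodGeometry.OffHyperplanes p →
          ((Projectivization.mk ℂ p hp, Projectivization.mk ℂ u hu) ∈
              LikelihoodGeometry.likelihoodCorrespondence (LikelihoodGeometry.toricModel A) ↔
            Projectivization.mk ℂ p hp ∈ LikelihoodGeometry.toricModel A ∧
              ∃ c : ℂ, (A.map (Int.cast : ℤ → ℂ)).mulVec u =
                c • (A.map (Int.cast : ℤ → ℂ)).mulVec p) := by
  open LikelihoodGeometry in
  refine ⟨toricLikelihoodIdeal_eq hhom, fun p u hp hu hoff => ⟨fun h => ?_, fun ⟨hM, hc⟩ => ?_⟩⟩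
  · have hvan (f : PURing n)
        (hf : f ∈ (toricIdeal A).map (MvPolynomial.rename Sum.inl : PRing n →ₐ[ℂ] PURing n) +
          minorsIdeal 2 (A.map (Int.cast : ℤ → PURing n) * dataMatrix n)) :
        VanishesAt₂ f (Projectivization.mk ℂ p hp, Projectivization.mk ℂ u hu) := by
      have h1 : f ∈ toricLikelihoodIdeal A :=
        (mem_saturation_span_singleton_iff _ _ _).mpr ⟨0, by rwa [pow_zero, mul_one]⟩
      rw [toricLikelihoodIdeal_eq hhom] at h1
      exact h1 _ h
    constructor
    · intro f hf q hq hqp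
      rw [vanishingIdeal_range_eq hhom] at hf
      have h1 := hvan (MvPolynomial.rename Sum.inl f)
        (Submodule.mem_sup_left (Ideal.mem_map_of_mem _ hf)) q u hq hu (by rw [hqp])
      rwa [MvPolynomial.eval_rename, Sum.elim_comp_inl] at h1
    · -- The moment equations lie in the likelihood ideal, so they hold on the closure.
      refine ⟨(∑ j, u j) / ∑ j, p j, ?_⟩
      ext i
      have h1 := hvan _ (Submodule.mem_sup_right (momentEquation_mem_minorsIdeal hhom i)) p u hp hu
        rfl
      rw [eval_momentEquation, sub_eq_zero] at h1
      rw [Pi.smul_apply, smul_eq_mul, div_mul_eq_mul_div, eq_div_iff hoff.2, mul_comm, h1]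
  · exact fun f hf => hf _ ((mem_criticalPairs_iff hhom hp hu).mpr ⟨hM, hoff, hc⟩)
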